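/- Let $L$ be a (possibly many-sorted) first-order language, $T$ a complete $L$-theory, $x$ a tuple of variables. For a model $M\models T$, let $L_x(M)$ be the Boolean algebra of subsets of $M_x$ that are definable in $M$ with parameters, and write $\psi(M,c)=\{a\in M_x: M\models\psi(a,c)\}$. Let $I$ be a $\bigvee$-definable ideal schema for $T$ in the context $x$: it assigns to each $L$-formula $\psi(x,z)$ ($z$ a finite tuple of variables) a set $\neg Ix.\psi(x,z)$ of $L$-formulas in the variables $z$, such that for every $M\models T$, (1) whether $c\in M_z$ satisfies all formulas in $\neg Ix.\psi(x,z)$ depends only on the set $\psi(M,c)$, and (2) the family $I(M)$ of all sets $\psi(M,c)$ for which $c$ does not satisfy $\neg Ix.\psi(x,z)$ is an ideal of $L_x(M)$. A formula over $M$ in the variables $x$ is $I$-thin if the set it defines is in $I(M)$, and $I$-wide otherwise; a set of such formulas is $I$-wide if every finite conjunction of its members is $I$-wide. Let $\phi(x,y)$ be an $L$-formula, $y$ a finite tuple of variables. * $\phi$ has the wide order property if there are $M\models T$, $a_i\in M_x$ and $b_i\in M_y$ $(i\in\omega)$ such that for all $i,j$, $M\models\phi(a_i,b_j)$ if and only if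 $i<j$, and for all $i$ the complete $\phi$-type of $a_i$ over the set of all entries of the tuples $b_j$, $j\in\omega$ (i.e. the set of finite Boolean combinations of formulas $\phi(x,b)$, $b$ a tuple from this set, that hold at $a_i$) is $I$-wide. * $\phi$ has the wide independence property if there are $M\models T$ and $b_i\in M_y$ $(i\in\omega)$ such that for every $\sigma\in 2^\omega$ the set $\{\phi(x,b_i)^{\sigma(i)}: i\in\omega\}$ is $I$-wide, where $\phi^1=\phi$ and $\phi^0=\neg\phi$. * A sequence $(d_i)_{i\in\omega}$ in $M_z$, $M\models T$, witnesses the wide strict order property of a formula $\psi(x,z)$ if for all $i<j$ the formula $\neg\psi(x,d_i)\wedge\psi(x,d_j)$ is $I$-wide and the formula $\psi(x,d_i)\wedge\neg\psi(x,d_j)$ is $I$-thin. **Theorem.** If $\phi$ has the wide order property, then either $\phi$ has the wide independence property, or some Boolean combination of instances of $\phi$ has the wide strict order property: there are $n\in\omega$, a Boolean combination $\psi(x,y_0,\dots,y_n)$ of the formulas $\phi(x,y_0),\dots,\phi(x,y_n)$ (where $y_0,\dots,y_n$ are disjoint copies of $y$), a model $M\models T$, tuples $c_0,\dots,c_{n-1}\in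 M_y$ and a sequence $(b_k)_{k\in\omega}$ in $M_y$ such that the sequence $\big((c_0,\dots,c_{n-1},b_k)\big)_{k\in\omega}$ witnesses the wide strict order property of $\psi(x,y_0\cdots y_n)$. -/

import Mathlib

universe u w

/-- A many-sorted first-order signature (with equality, which is treated as a logical symbol). -/
structure SortedLanguage where
  /-- the sorts -/
  Sorts : Type u
  /-- the function symbols (constants are the function symbols of arity `0`) -/
  Func : Type u
  /-- the arity of a function symbol -/
  funcArity : Func → ℕ
  /-- the sorts of the arguments of a function symbol -/
  funcDom : (f : Func) → Fin (funcArity f) → Sorts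
  /-- the sort of the values of a function symbol -/
  funcCod : Func → Sorts
  /-- the relation symbols -/
  Rel : Type u
  /-- the arity of a relation symbol -/
  relArity : Rel → ℕ
  /-- the sorts of the arguments of a relation symbol -/
  relDom : (r : Rel) → Fin (relArity r) → Sorts

namespace SortedLanguage

/-- `L.Term σ s` : terms of sort `s` in variables `v : V`, the variable `v` being of sort `σ v`. -/
inductive Term (L : SortedLanguage.{u}) {V : Type} (σ : V → L.Sorts) : L.Sorts → Type u
  | var (v : V) : Term L σ (σ v)
  | func (f : L.Func) (ts : ∀ i, Term L σ (L.funcDom f i)) : Term L σ (L.funcCod f)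

/-- The sorts of the variables of a formula under a list `l` of quantifiers: the free variables
`v : V`, and one bound variable for each entry of `l`. -/
abbrev boundSort (L : SortedLanguage.{u}) {V : Type} (σ : V → L.Sorts) (l : List L.Sorts) :
    V ⊕ Fin l.length → L.Sorts :=
  Sum.elim σ l.get

/-- First-order formulas with free variables among `V` (the variable `v` being of sort `σ v`) and
among bound variables whose sorts are listed in `l` (de Bruijn style, innermost first). -/
inductive BoundedFormula (L : SortedLanguage.{u}) {V : Type} (σ : V → L.Sorts) :
    List L.Sorts → Type u
  | falsum {l : List L.Sorts} : BoundedFormula L σ l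
  | equal {l : List L.Sorts} {s : L.Sorts} (t₁ t₂ : L.Term (L.boundSort σ l) s) :
      BoundedFormula L σ l
  | rel {l : List L.Sorts} (r : L.Rel) (ts : ∀ i, L.Term (L.boundSort σ l) (L.relDom r i)) :
      BoundedFormula L σ l
  | imp {l : List L.Sorts} (φ ψ : BoundedFormula L σ l) : BoundedFormula L σ l
  | all {l : List L.Sorts} (s : L.Sorts) (φ : BoundedFormula L σ (s :: l)) : BoundedFormula L σ l

/-- Formulas whose free variables are among the `v : V`, with `v` of sort `σ v`. -/
abbrev Formula (L : SortedLanguage.{u}) {V : Type} (σ : V → L.Sorts) : Type u :=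
  L.BoundedFormula σ []

/-- Sentences: formulas without free variables. -/
abbrev Sentence (L : SortedLanguage.{u}) : Type u :=
  L.Formula (V := Empty) (fun e => e.elim)

/-- Theories: sets of sentences. -/
abbrev Theory (L : SortedLanguage.{u}) : Type u := Set L.Sentence

/-- Simultaneous substitution of terms for variables in a term. -/
def Term.subst {L : SortedLanguage.{u}} {V W : Type} {σ : V → L.Sorts} {τ : W → L.Sorts}
    (f : ∀ v, L.Term τ (σ v)) : ∀ {s : L.Sorts}, L.Term σ s → L.Term τ s
  | _, .var v => f v
  | _, .func g ts => .func g fun i => (ts i).subst f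

/-- The substitution under a list `l` of quantifiers that is induced by a substitution `f` for the
free variables; bound variables stay as they are. -/
def liftSubst {L : SortedLanguage.{u}} {V W : Type} {σ : V → L.Sorts} {τ : W → L.Sorts}
    (f : ∀ v, L.Term τ (σ v)) (l : List L.Sorts) :
    ∀ v : V ⊕ Fin l.length, L.Term (L.boundSort τ l) (L.boundSort σ l v)
  | .inl v => (f v).subst (τ := L.boundSort τ l) fun w => .var (σ := L.boundSort τ l) (.inl w)
  | .inr i => .var (σ := L.boundSort τ l) (.inr i)

/-- Simultaneous (capture-free) substitution of terms for the free variables of a formula. -/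
def BoundedFormula.subst {L : SortedLanguage.{u}} {V W : Type} {σ : V → L.Sorts} {τ : W → L.Sorts}
    (f : ∀ v, L.Term τ (σ v)) : ∀ {l : List L.Sorts}, L.BoundedFormula σ l → L.BoundedFormula τ l
  | _, .falsum => .falsum
  | l, .equal t₁ t₂ => .equal (t₁.subst (liftSubst f l)) (t₂.subst (liftSubst f l))
  | l, .rel r ts => .rel r fun i => (ts i).subst (liftSubst f l)
  | _, .imp φ ψ => .imp (φ.subst f) (ψ.subst f)
  | _, .all s φ => .all s (φ.subst f)

/-- Structures for a many-sorted language; as usual, the domain of each sort is nonempty. -/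
structure Struct (L : SortedLanguage.{u}) where
  /-- the domain of each sort -/
  carrier : L.Sorts → Type w
  nonempty : ∀ s, Nonempty (carrier s)
  /-- the interpretation of the function symbols -/
  funMap : ∀ f : L.Func, (∀ i, carrier (L.funcDom f i)) → carrier (L.funcCod f)
  /-- the interpretation of the relation symbols -/
  relMap : ∀ r : L.Rel, (∀ i, carrier (L.relDom r i)) → Prop

/-- `M.Tuple σ` is the set `M_x` of tuples of elements of `M` of the sorts prescribed by a tuple
`x` of variables, given by its index type `V` and the sorts `σ v` of its entries. -/
abbrev Struct.Tuple {L : SortedLanguage.{u}} (M : Struct.{u, w} L) {V : Type}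
    (σ : V → L.Sorts) : Type w :=
  ∀ v, M.carrier (σ v)

/-- The concatenation of two tuples. -/
def Struct.append {L : SortedLanguage.{u}} {M : Struct.{u, w} L} {V W : Type}
    {σ : V → L.Sorts} {τ : W → L.Sorts} (a : M.Tuple σ) (b : M.Tuple τ) :
    M.Tuple (Sum.elim σ τ)
  | .inl v => a v
  | .inr v => b v

/-- Adds a value for a new innermost bound variable. -/
def Struct.cons {L : SortedLanguage.{u}} {M : Struct.{u, w} L} {s : L.Sorts} {l : List L.Sorts}
    (m : M.carrier s) (xs : M.Tuple l.get) : M.Tuple (s :: l).get :=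
  fun i => Fin.cases (motive := fun i => M.carrier ((s :: l).get i)) m xs i

/-- The value of a term. -/
def Term.realize {L : SortedLanguage.{u}} {M : Struct.{u, w} L} {V : Type} {σ : V → L.Sorts}
    (a : M.Tuple σ) : ∀ {s : L.Sorts}, L.Term σ s → M.carrier s
  | _, .var v => a v
  | _, .func f ts => M.funMap f fun i => (ts i).realize a

/-- Truth of a formula under an assignment of its free and bound variables. -/
def BoundedFormula.Realize {L : SortedLanguage.{u}} {M : Struct.{u, w} L} {V : Type}
    {σ : V → L.Sorts} (a : M.Tuple σ) :
    ∀ {l : List L.Sorts}, L.BoundedFormula σ l → M.Tuple l.get → Prop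
  | _, .falsum, _ => False
  | _, .equal t₁ t₂, xs => t₁.realize (Struct.append a xs) = t₂.realize (Struct.append a xs)
  | _, .rel r ts, xs => M.relMap r fun i => (ts i).realize (Struct.append a xs)
  | _, .imp φ ψ, xs => φ.Realize a xs → ψ.Realize a xs
  | _, .all s φ, xs => ∀ m : M.carrier s, φ.Realize a (Struct.cons m xs)

/-- `M ⊨ φ(a)`. -/
def Struct.Sat {L : SortedLanguage.{u}} (M : Struct.{u, w} L) {V : Type} {σ : V → L.Sorts}
    (φ : L.Formula σ) (a : M.Tuple σ) : Prop :=
  BoundedFormula.Realize a φ fun i => i.elim0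

/-- `M ⊨ T`. -/
def Struct.Models {L : SortedLanguage.{u}} (M : Struct.{u, w} L) (T : L.Theory) : Prop :=
  ∀ φ ∈ T, M.Sat φ fun e => e.elim

/-- `T` has a model. -/
def Theory.Satisfiable {L : SortedLanguage.{u}} (T : L.Theory) : Prop :=
  ∃ M : Struct.{u, w} L, M.Models T

/-- `T` is complete: maximal among the satisfiable theories. -/
def Theory.Complete {L : SortedLanguage.{u}} (T : L.Theory) : Prop :=
  Maximal (fun T' : L.Theory => Theory.Satisfiable.{u, w} T') T

/-! A partitioned formula `φ(x, y)` in the context `x` and parameters `y` is a formula whose free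
variables are indexed by `X ⊕ Y`, where `X`, `Y` index the tuples `x`, `y`. -/

/-- The definable set `ψ(M, c) = {a ∈ M_x : M ⊨ ψ(a, c)}`. The Lindenbaum--Tarski algebra
`L_x(M)` is identified with the Boolean algebra of all these sets, for all `ψ` and `c`. -/
def Struct.points {L : SortedLanguage.{u}} (M : Struct.{u, w} L) {X Y : Type}
    {ξ : X → L.Sorts} {η : Y → L.Sorts} (ψ : L.Formula (Sum.elim ξ η)) (c : M.Tuple η) :
    Set (M.Tuple ξ) :=
  {a | M.Sat ψ (Struct.append a c)}

/-- `D ⊆ M_x` is definable in `M` with parameters. -/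
def Struct.IsDefinable {L : SortedLanguage.{u}} (M : Struct.{u, w} L) {X : Type}
    {ξ : X → L.Sorts} (D : Set (M.Tuple ξ)) : Prop :=
  ∃ (Y : Type) (_ : Finite Y) (η : Y → L.Sorts) (ψ : L.Formula (Sum.elim ξ η)) (c : M.Tuple η),
    M.points ψ c = D

/-- A `⋁`-preschema of partial types in the context `x`: to each partitioned formula `ψ(x, y)`,
`y` a finite tuple of any sorts, it assigns a set `¬Ix.ψ(x, y)` of formulas in the
variables `y`. -/
structure Preschema (L : SortedLanguage.{u}) {X : Type} (ξ : X → L.Sorts) where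
  /-- the set of formulas `¬Ix.ψ(x, y)` -/
  negI : ∀ {Y : Type} [Finite Y] {η : Y → L.Sorts}, L.Formula (Sum.elim ξ η) → Set (L.Formula η)

namespace Preschema

variable {L : SortedLanguage.{u}} {X : Type} {ξ : X → L.Sorts}

/-- `M ⊨ ¬Ix.ψ(x, c)`: all formulas of the set `¬Ix.ψ(x, y)` hold at `c`. -/
def SatNegI (I : Preschema L ξ) (M : Struct.{u, w} L) {Y : Type} [Finite Y] {η : Y → L.Sorts}
    (ψ : L.Formula (Sum.elim ξ η)) (c : M.Tuple η) : Prop :=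
  ∀ θ ∈ I.negI ψ, M.Sat θ c

/-- The family `I(M)` of definable sets: those represented by some `ψ(x, c)` such that
`M ⊨ ¬Ix.ψ(x, c)` fails. -/
def idealAt (I : Preschema L ξ) (M : Struct.{u, w} L) : Set (Set (M.Tuple ξ)) :=
  {D | ∃ (Y : Type) (_ : Finite Y) (η : Y → L.Sorts) (ψ : L.Formula (Sum.elim ξ η))
    (c : M.Tuple η), M.points ψ c = D ∧ ¬ I.SatNegI M ψ c}

/-- `I` is `∼_M`-invariant: whether `M ⊨ ¬Ix.ψ(x, c)` depends only on the set `ψ(M, c)`. -/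
def Invariant (I : Preschema L ξ) (M : Struct.{u, w} L) : Prop :=
  ∀ {Y Z : Type} [Finite Y] [Finite Z] {η : Y → L.Sorts} {ζ : Z → L.Sorts}
    (ψ : L.Formula (Sum.elim ξ η)) (c : M.Tuple η)
    (θ : L.Formula (Sum.elim ξ ζ)) (d : M.Tuple ζ),
    M.points ψ c = M.points θ d → (I.SatNegI M ψ c ↔ I.SatNegI M θ d)

/-- `I` `⋁`-defines an ideal of `L_x(M)`: it is `∼_M`-invariant, and `I(M)` is an ideal of the
Boolean algebra of definable subsets of `M_x`. -/
structure DefinesIdeal (I : Preschema L ξ) (M : Struct.{u, w} L) : Prop where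
  invariant : I.Invariant M
  empty_mem : ∅ ∈ I.idealAt M
  union_mem : ∀ D ∈ I.idealAt M, ∀ E ∈ I.idealAt M, D ∪ E ∈ I.idealAt M
  subset_mem : ∀ D ∈ I.idealAt M, ∀ E, M.IsDefinable E → E ⊆ D → E ∈ I.idealAt M

/-- `I` is a `⋁`-definable ideal schema for `T`. -/
def IsIdealSchema (I : Preschema L ξ) (T : L.Theory) : Prop :=
  ∀ M : Struct.{u, w} L, M.Models T → I.DefinesIdeal M

/-- A set `p` of definable subsets of `M_x` (that is, of formulas over `M` up to equivalence) is
`I`-wide: no meet of finitely many of its members is in `I(M)`. -/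
def Wide (I : Preschema L ξ) (M : Struct.{u, w} L) (p : Set (Set (M.Tuple ξ))) : Prop :=
  ∀ F : Set (Set (M.Tuple ξ)), F.Finite → F ⊆ p → ⋂₀ F ∉ I.idealAt M

variable {Y : Type} {η : Y → L.Sorts}

/-- The set `⋃ⱼ bⱼ` of all entries of the tuples `bⱼ`, as a set of elements of `M`. -/
def entries {M : Struct.{u, w} L} (b : ℕ → M.Tuple η) : Set (Σ s, M.carrier s) :=
  {p | ∃ j k, p = ⟨η k, b j k⟩}

/-- The complete `φ`-type `tp_φ(a / B)`: all finite Boolean combinations of sets `φ(M, c)`, with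
`c` a tuple from `B`, that contain `a`. -/
def phiType {M : Struct.{u, w} L} (φ : L.Formula (Sum.elim ξ η)) (a : M.Tuple ξ)
    (B : Set (Σ s, M.carrier s)) : Set (Set (M.Tuple ξ)) :=
  {D | D ∈ BooleanSubalgebra.closure
      {E : Set (M.Tuple ξ) | ∃ c : M.Tuple η, (∀ k, ⟨η k, c k⟩ ∈ B) ∧ M.points φ c = E} ∧ a ∈ D}

/-- `M` realizes an infinite `I`-wide `φ`-order. -/
def RealizesWideOrder (I : Preschema L ξ) (M : Struct.{u, w} L)
    (φ : L.Formula (Sum.elim ξ η)) : Prop :=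
  ∃ (a : ℕ → M.Tuple ξ) (b : ℕ → M.Tuple η),
    (∀ i j, M.Sat φ (Struct.append (a i) (b j)) ↔ i < j) ∧
    ∀ i, I.Wide M (phiType φ (a i) (entries b))

/-- `φ` has the wide order property in `T` with respect to `I`. -/
def HasWideOP (I : Preschema L ξ) (T : L.Theory) (φ : L.Formula (Sum.elim ξ η)) : Prop :=
  ∃ M : Struct.{u, w} L, M.Models T ∧ I.RealizesWideOrder M φ

/-- `φ` has the wide independence property in `M`: there are `bᵢ` such that for each `σ ∈ 2^ω`, the
set `{φ(x, bᵢ)^σ(i) : i ∈ ω}` is `I`-wide, where `φ¹ = φ` and `φ⁰ = ¬φ`. -/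
def HasWideIPIn (I : Preschema L ξ) (M : Struct.{u, w} L)
    (φ : L.Formula (Sum.elim ξ η)) : Prop :=
  ∃ b : ℕ → M.Tuple η, ∀ σ : ℕ → Bool,
    I.Wide M (Set.range fun i => if σ i then M.points φ (b i) else (M.points φ (b i))ᶜ)

/-- `φ` has the wide independence property in `T` with respect to `I`. -/
def HasWideIP (I : Preschema L ξ) (T : L.Theory) (φ : L.Formula (Sum.elim ξ η)) : Prop :=
  ∃ M : Struct.{u, w} L, M.Models T ∧ I.HasWideIPIn M φ

/-- The sequence `b` in `M` witnesses the wide strict order property of `ψ(x, y)`: for `i < j`, the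
formula `¬ψ(x, bᵢ) ∧ ψ(x, bⱼ)` is `I`-wide, whereas `ψ(x, bᵢ) ∧ ¬ψ(x, bⱼ)` is `I`-thin. -/
def IsWideSOPSequence (I : Preschema L ξ) (M : Struct.{u, w} L)
    (ψ : L.Formula (Sum.elim ξ η)) (b : ℕ → M.Tuple η) : Prop :=
  ∀ i j, i < j →
    (M.points ψ (b i))ᶜ ∩ M.points ψ (b j) ∉ I.idealAt M ∧
    M.points ψ (b i) ∩ (M.points ψ (b j))ᶜ ∈ I.idealAt M

end Preschema

/-- The formula `φ(x, yⱼ)`, where `(y₀, …, yₙ₋₁)` is a tuple of `n` disjoint copies of `y`. -/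
def copy {L : SortedLanguage.{u}} {X Y : Type} {ξ : X → L.Sorts} {η : Y → L.Sorts}
    (φ : L.Formula (Sum.elim ξ η)) {n : ℕ} (j : Fin n) :
    L.Formula (Sum.elim ξ fun p : Fin n × Y => η p.2) :=
  φ.subst fun
    | .inl i => .var (σ := Sum.elim ξ fun p : Fin n × Y => η p.2) (.inl i)
    | .inr k => .var (σ := Sum.elim ξ fun p : Fin n × Y => η p.2) (.inr (j, k))

/-- The Boolean combinations of formulas from a set `S`. The connectives `⊥` and `→` generate the
others: `¬α` is `α → ⊥`, and `α ∧ β` is `¬(α → ¬β)`. -/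
inductive IsBooleanCombination {L : SortedLanguage.{u}} {V : Type} {σ : V → L.Sorts}
    (S : Set (L.Formula σ)) : L.Formula σ → Prop
  | basic {α : L.Formula σ} (h : α ∈ S) : IsBooleanCombination S α
  | falsum : IsBooleanCombination S .falsum
  | imp {α β : L.Formula σ} (hα : IsBooleanCombination S α) (hβ : IsBooleanCombination S β) :
      IsBooleanCombination S (.imp α β)

/-- The tuple `(c₀, …, cₙ₋₁)` of `y`-tuples, as one tuple for `n` disjoint copies of `y`. -/
def Struct.join {L : SortedLanguage.{u}} {M : Struct.{u, w} L} {Y : Type} {η : Y → L.Sorts}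
    {n : ℕ} (c : Fin n → M.Tuple η) : M.Tuple fun p : Fin n × Y => η p.2 :=
  fun p => c p.1 p.2

end SortedLanguage

/-! Call a word `s` of length `n` wide along parameters `c₀, …, cₙ₋₁` if the conjunction of the
`φ(x, cⱼ)^{s j}` is wide. Because `I` is `⋁`-definable, this says that `c` satisfies a set of
formulas in the parameter variables alone. If the parameters come from an order-invariant sequence,
meaning that every increasing tuple satisfies the same formulas, then wideness depends only on `s`.

Such a sequence is found in an ultrapower (`exists_orderInvariant_ultrapower`): increasing tuples
realize the average type of the `b`'s along a nonprincipal ultrafilter on `ℕ`, computed by iterating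
the quantifier "for almost all". A word `0ᵏ1ᵐ` is wide there, since in the given order it belongs to
the wide `φ`-type of some `aᵢ` (`iteratedEventually_sat_negI`).

If all words are wide, `φ` has the wide independence property. Otherwise, sort letters by adjacent
swaps: some `α01β` is wide while `α10β` is thin (`exists_swap`). Fix the parameters for `α` and `β`
and let the middle pair run through infinitely many places between them. The conjunction of `φ(x,
b)` with the pattern `αβ` then has the wide strict order property. The places for `β` must lie above
infinitely many others, so a sequence of order type `ω` is too short; the ultrapower supplies one of
nonstandard finite length. -/

namespace SortedLanguage

open Filter

/-! ### Ultrapowers and Łoś's theorem -/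

section Ultrapower

variable {L : SortedLanguage.{u}} {M : Struct.{u, max u w} L} {D : Type u} {U : Ultrafilter D}

/-- The ultrapower of a many-sorted structure. -/
noncomputable def Struct.ultrapower (M : Struct.{u, max u w} L) {D : Type u} (U : Ultrafilter D) :
    Struct.{u, max u w} L where
  carrier s := Germ (U : Filter D) (M.carrier s)
  nonempty s := ⟨((fun _ => (M.nonempty s).some : D → M.carrier s) : Germ (U : Filter D) _)⟩
  funMap f ts := ((fun d => M.funMap f fun i => Quotient.out (ts i) d : D → _) :
    Germ (U : Filter D) _)
  relMap r ts := ∀ᶠ d in (U : Filter D), M.relMap r fun i => Quotient.out (ts i) d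

/-- The tuple of the ultrapower that is represented by a family of tuples. -/
def Struct.germTuple (U : Ultrafilter D) {V : Type} {σ : V → L.Sorts} (g : D → M.Tuple σ) :
    (M.ultrapower U).Tuple σ :=
  fun v => ((fun d => g d v : D → M.carrier (σ v)) : Germ (U : Filter D) _)

theorem Struct.append_germTuple {V W : Type} {σ : V → L.Sorts} {τ : W → L.Sorts}
    (g : D → M.Tuple σ) (h : D → M.Tuple τ) :
    Struct.append (germTuple U g) (germTuple U h) =
      germTuple U fun d => Struct.append (g d) (h d) := by
  funext v
  cases v <;> rfl

theorem Struct.cons_germTuple {s : L.Sorts} {l : List L.Sorts}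
    (m : D → M.carrier s) (h : D → M.Tuple l.get) :
    Struct.cons (M := M.ultrapower U) (m : Germ (U : Filter D) (M.carrier s)) (germTuple U h) =
      germTuple U fun d => Struct.cons (m d) (h d) := by
  funext v
  refine Fin.cases ?_ (fun i => ?_) v <;> rfl

/-- Symbols are interpreted in the ultrapower through chosen representatives. Since arities are
finite, the choice is immaterial on a set in `U`. -/
theorem eventually_out_eq {n : ℕ} {A : Fin n → Type*} (g : ∀ i, D → A i) :
    ∀ᶠ d in (U : Filter D), ∀ i,
      Quotient.out ((g i : Germ (U : Filter D) (A i))) d = g i d := by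
  refine eventually_all.2 fun i => ?_
  exact Quotient.exact (Quotient.out_eq ((g i : Germ (U : Filter D) (A i))))

theorem Term.realize_germTuple {V : Type} {σ : V → L.Sorts} (g : D → M.Tuple σ) {s : L.Sorts}
    (t : L.Term σ s) :
    t.realize (Struct.germTuple U g) =
      ((fun d => t.realize (g d) : D → M.carrier s) : Germ (U : Filter D) _) := by
  induction t with
  | var v => rfl
  | func f ts ih =>
    simp only [Term.realize, ih]
    refine Germ.coe_eq.2 ?_
    filter_upwards [eventually_out_eq (U := U) fun i d => (ts i).realize (g d)] with d hd
    simp only [hd]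

/-- Łoś's theorem. -/
theorem BoundedFormula.realize_germTuple {V : Type} {σ : V → L.Sorts} (g : D → M.Tuple σ)
    {l : List L.Sorts} (φ : L.BoundedFormula σ l) (h : D → M.Tuple l.get) :
    φ.Realize (Struct.germTuple U g) (Struct.germTuple U h) ↔
      ∀ᶠ d in (U : Filter D), φ.Realize (g d) (h d) := by
  induction φ with
  | falsum => simpa [BoundedFormula.Realize] using U.neBot.ne
  | equal t₁ t₂ =>
    simp only [BoundedFormula.Realize, Struct.append_germTuple, Term.realize_germTuple]
    exact Germ.coe_eq
  | rel r ts =>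
    simp only [BoundedFormula.Realize, Struct.append_germTuple, Term.realize_germTuple]
    refine eventually_congr ?_
    filter_upwards [eventually_out_eq (U := U)
      fun i d => (ts i).realize (Struct.append (g d) (h d))] with d hd
    simp only [hd]
  | imp φ ψ ihφ ihψ =>
    simp only [BoundedFormula.Realize, ihφ, ihψ]
    exact Ultrafilter.eventually_imp.symm
  | all s φ ih =>
    simp only [BoundedFormula.Realize]
    constructor
    · intro H
      by_contra hn
      rw [← Ultrafilter.eventually_not] at hn
      have : ∀ d, ∃ m : M.carrier s, (¬ ∀ m, φ.Realize (g d) (Struct.cons m (h d))) →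
          ¬ φ.Realize (g d) (Struct.cons m (h d)) := fun d => by
        by_cases hd : ∀ m, φ.Realize (g d) (Struct.cons m (h d))
        · exact ⟨(M.nonempty s).some, fun h => (h hd).elim⟩
        · obtain ⟨m, hm⟩ := not_forall.1 hd
          exact ⟨m, fun _ => hm⟩
      choose m hm using this
      have H' := H (m : Germ (U : Filter D) (M.carrier s))
      rw [Struct.cons_germTuple, ih] at H'
      obtain ⟨d, h₁, h₂⟩ := (H'.and hn).exists
      exact hm d h₂ h₁
    · intro H m
      obtain ⟨m, rfl⟩ := Quotient.exists_rep m
      change φ.Realize _ (Struct.cons (M := M.ultrapower U)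
        (m : Germ (U : Filter D) (M.carrier s)) _)
      rw [Struct.cons_germTuple, ih]
      filter_upwards [H] with d hd using hd _

theorem Struct.sat_germTuple {V : Type} {σ : V → L.Sorts} (g : D → M.Tuple σ) (φ : L.Formula σ) :
    (M.ultrapower U).Sat φ (germTuple U g) ↔ ∀ᶠ d in (U : Filter D), M.Sat φ (g d) := by
  have h : (fun i => i.elim0 : (M.ultrapower U).Tuple ([] : List L.Sorts).get) =
    germTuple U (fun _ i => i.elim0) := funext fun i => i.elim0
  unfold Struct.Sat
  rw [h]
  exact BoundedFormula.realize_germTuple g φ _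

theorem Struct.Models.ultrapower {T : L.Theory} (h : M.Models T) :
    (M.ultrapower U).Models T := fun φ hφ => by
  rw [show (fun e => e.elim : (M.ultrapower U).Tuple fun e : Empty => e.elim) =
    germTuple U (fun _ e => e.elim) from funext fun e => e.elim, sat_germTuple]
  exact Eventually.of_forall fun _ => h φ hφ

end Ultrapower

/-! ### Average types and generic finite sequences -/

section IteratedQuantifier

/-- `R` holds at `[i₁, …, iₙ]` for `V`-almost all `i₁`, for `V`-almost all `i₂`, and so on. -/
def IteratedEventually (V : Ultrafilter ℕ) : ℕ → (List ℕ → Prop) → Prop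
  | 0, R => R []
  | n + 1, R => ∀ᶠ i in (V : Filter ℕ), IteratedEventually V n fun v => R (i :: v)

variable {V : Ultrafilter ℕ}

theorem IteratedEventually.mono {n : ℕ} {R S : List ℕ → Prop} (h : IteratedEventually V n R)
    (hRS : ∀ v, R v → S v) : IteratedEventually V n S := by
  induction n generalizing R S with
  | zero => exact hRS _ h
  | succ n ih => exact Eventually.mono h fun i hi => ih hi fun v => hRS _

theorem iteratedEventually_not {n : ℕ} {R : List ℕ → Prop} :
    IteratedEventually V n (fun v => ¬ R v) ↔ ¬ IteratedEventually V n R := by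
  induction n generalizing R with
  | zero => rfl
  | succ n ih =>
    simp only [IteratedEventually, ih]
    exact Ultrafilter.eventually_not

/-- The lower bound `m` serves the induction: it becomes the index chosen last. -/
theorem iteratedEventually_increasing (hV : (V : Filter ℕ) ≤ atTop) (n m : ℕ) :
    IteratedEventually V n fun v => v.length = n ∧ (m :: v).Pairwise (· < ·) := by
  induction n generalizing m with
  | zero => simp [IteratedEventually]
  | succ n ih =>
    filter_upwards [hV (eventually_gt_atTop m)] with i hi
    refine (ih i).mono fun v hv => ⟨by simp [hv.1], ?_⟩
    rw [List.pairwise_cons]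
    refine ⟨fun j hj => ?_, hv.2⟩
    rcases List.mem_cons.1 hj with rfl | hj
    · exact hi
    · exact hi.trans ((List.pairwise_cons.1 hv.2).1 j hj)

/-- Every sublist of `l` of length `k ≤ n` can be extended to satisfy `R`, in the generic way. -/
def IsGeneric (V : Ultrafilter ℕ) (n : ℕ) (R : List ℕ → Prop) (l : List ℕ) : Prop :=
  ∀ k m v, k + m = n → v.length = k → v.Sublist l → IteratedEventually V m fun t => R (v ++ t)

/-- A sublist of `l ++ [i]` either lies in `l` or is a sublist of `l` followed by `i`. In the second
case the outermost quantifier for the shorter sublist allows almost all `i`, and there are only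
finitely many sublists. -/
theorem IsGeneric.eventually {n : ℕ} {R : List ℕ → Prop} {l : List ℕ} (h : IsGeneric V n R l) :
    ∀ᶠ i in (V : Filter ℕ), IsGeneric V n R (l ++ [i]) := by
  have key : ∀ v ∈ {v | v ∈ l.sublists}, ∀ᶠ i in (V : Filter ℕ), ∀ m, v.length + (m + 1) = n →
      IteratedEventually V m fun t => R (v ++ i :: t) := by
    intro v hv
    by_cases hn : v.length < n
    · obtain ⟨m, hm⟩ : ∃ m, v.length + (m + 1) = n := ⟨n - v.length - 1, by omega⟩
      have := h _ (m + 1) v hm rfl (List.mem_sublists.1 hv)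
      filter_upwards [this] with i hi m' hm'
      obtain rfl : m' = m := by omega
      exact hi
    · exact Eventually.of_forall fun i m hm => by omega
  filter_upwards [(eventually_all_finite (List.finite_toSet l.sublists)).2 key] with i hi
  intro k m v hkm hvk hv
  obtain ⟨v₁, v₂, rfl, h₁, h₂⟩ := List.sublist_append_iff.1 hv
  rcases List.sublist_singleton.1 h₂ with rfl | rfl
  · simpa using h k m v₁ hkm (by simpa using hvk) h₁
  · have := hi v₁ (List.mem_sublists.2 h₁) m (by simp at hvk; omega)
    simpa using this

theorem exists_isGeneric {ι : Type*} (A : Finset ι) (n : ι → ℕ) (R : ι → List ℕ → Prop)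
    (h : ∀ i ∈ A, IteratedEventually V (n i) (R i)) (N : ℕ) :
    ∃ l : List ℕ, l.length = N ∧ ∀ i ∈ A, IsGeneric V (n i) (R i) l := by
  induction N with
  | zero =>
    refine ⟨[], rfl, fun i hi k m v hkm hk hv => ?_⟩
    obtain rfl := List.sublist_nil.1 hv
    obtain rfl : m = n i := by simp at hk; omega
    simpa using h i hi
  | succ N ih =>
    obtain ⟨l, hl, hA⟩ := ih
    obtain ⟨j, hj⟩ := ((eventually_all_finset A).2 fun i hi => (hA i hi).eventually).exists
    exact ⟨l ++ [j], by simp [hl], hj⟩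

/-- The iterated quantifier commutes with negation, so "`R` has its generic truth value" always
holds generically. Genericity is applied to this property. The list itself need not be increasing;
only the order of its places matters. -/
theorem exists_isGeneric_iff {ι : Type*} (A : Finset ι) (n : ι → ℕ) (R : ι → List ℕ → Prop)
    (N : ℕ) :
    ∃ l : List ℕ, l.length = N ∧ ∀ i ∈ A, ∀ v : List ℕ, v.length = n i → v.Sublist l →
      (R i v ↔ IteratedEventually V (n i) (R i)) := by
  obtain ⟨l, hl, h⟩ := exists_isGeneric A n
    (fun i v => R i v ↔ IteratedEventually V (n i) (R i)) (fun i _ => by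
      by_cases hi : IteratedEventually V (n i) (R i)
      · exact hi.mono fun v hv => iff_of_true hv hi
      · exact (iteratedEventually_not.2 hi).mono fun v hv => iff_of_false hv hi) N
  refine ⟨l, hl, fun i hi v hv hvl => ?_⟩
  simpa [IteratedEventually] using h i hi (n i) 0 v rfl hv hvl

theorem ofFn_getD_sublist {n : ℕ} (l : List ℕ) (pos : Fin n → ℕ) (hpos : StrictMono pos)
    (hlt : ∀ j, pos j < l.length) : (List.ofFn fun j => l.getD (pos j) 0).Sublist l := by
  rw [List.sublist_iff_exists_fin_orderEmbedding_get_eq]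
  refine ⟨OrderEmbedding.ofStrictMono (fun j => ⟨pos (j.cast (by simp)), hlt _⟩)
    fun i j hij => hpos (by simpa using hij), fun j => ?_⟩
  simp only [List.get_eq_getElem, List.getElem_ofFn, List.getD_eq_getElem _ _ (hlt _)]
  rfl

end IteratedQuantifier

/-- A property of words that holds for `0ᵏ1ᵐ`, but not always, fails to be preserved by some
swap of consecutive letters `01`. -/
theorem exists_swap (S : List Bool → Prop)
    (h : ∀ k m, S (List.replicate k false ++ List.replicate m true)) (s : List Bool) (hs : ¬ S s) :
    ∃ α β, S (α ++ false :: true :: β) ∧ ¬ S (α ++ true :: false :: β) := by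
  by_contra! hc
  -- Bubble sort run backwards: if every swap `01 → 10` preserved `S`, a letter `1` could be carried
  -- left across a block of `0`s, and any word would be reached from its sorted form.
  have move : ∀ k α β, S (α ++ (List.replicate k false ++ true :: β)) →
      S (α ++ true :: (List.replicate k false ++ β)) := by
    intro k
    induction k with
    | zero => intro α β; exact id
    | succ k ih =>
      intro α β hS
      have := ih (α ++ [false]) β (by simpa [List.replicate_succ] using hS)
      simpa [List.replicate_succ] using
        hc α (List.replicate k false ++ β) (by simpa using this)
  have sort : ∀ s α, S (α ++ (List.replicate (s.count false) false ++
      List.replicate (s.count true) true)) → S (α ++ s) := by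
    intro s
    induction s with
    | nil => intro α; simp
    | cons x t ih =>
      intro α hS
      cases x
      · have := ih (α ++ [false]) (by simpa [List.replicate_succ] using hS)
        simpa using this
      · have := ih (α ++ [true]) (by
          simpa using move (t.count false) α (List.replicate (t.count true) true)
            (by simpa [List.replicate_succ] using hS))
        simpa using this
  exact hs (by simpa using sort s [] (by simpa using h _ _))

/-! ### Patterns of instances of the formula, and their wideness -/

section PatternSets

variable {L : SortedLanguage.{u}} {M : Struct.{u, w} L}

theorem Term.realize_subst {V W : Type} {σ : V → L.Sorts} {τ : W → L.Sorts}
    (f : ∀ v, L.Term τ (σ v)) (a : M.Tuple τ) {s : L.Sorts} (t : L.Term σ s) :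
    (t.subst f).realize a = t.realize fun v => (f v).realize a := by
  induction t with
  | var v => rfl
  | func g ts ih => simp only [Term.subst, Term.realize, ih]

theorem BoundedFormula.realize_subst {V W : Type} {σ : V → L.Sorts} {τ : W → L.Sorts}
    (f : ∀ v, L.Term τ (σ v)) (a : M.Tuple τ) {l : List L.Sorts} (φ : L.BoundedFormula σ l)
    (xs : M.Tuple l.get) :
    (φ.subst f).Realize a xs ↔ φ.Realize (fun v => (f v).realize a) xs := by
  have key : ∀ (l : List L.Sorts) (xs : M.Tuple l.get),
      (fun v => (liftSubst f l v).realize (Struct.append a xs)) =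
        Struct.append (fun v => (f v).realize a) xs := by
    intro l xs
    funext v
    cases v with
    | inl v => exact Term.realize_subst _ _ _
    | inr i => rfl
  induction φ with
  | falsum => rfl
  | equal t₁ t₂ => simp only [BoundedFormula.subst, BoundedFormula.Realize, Term.realize_subst, key]
  | rel r ts => simp only [BoundedFormula.subst, BoundedFormula.Realize, Term.realize_subst, key]
  | imp φ ψ ihφ ihψ => simp only [BoundedFormula.subst, BoundedFormula.Realize, ihφ, ihψ]
  | all s φ ih => simp only [BoundedFormula.subst, BoundedFormula.Realize, ih]

/-- The conjunction of a list of formulas. -/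
def Formula.conj {V : Type} {σ : V → L.Sorts} : List (L.Formula σ) → L.Formula σ
  | [] => .imp .falsum .falsum
  | α :: l => .imp (.imp α (.imp (conj l) .falsum)) .falsum

theorem Struct.sat_conj {V : Type} {σ : V → L.Sorts} (l : List (L.Formula σ)) (a : M.Tuple σ) :
    M.Sat (Formula.conj l) a ↔ ∀ α ∈ l, M.Sat α a := by
  induction l with
  | nil => simp [Formula.conj, Struct.Sat, BoundedFormula.Realize]
  | cons α l ih =>
    rw [List.forall_mem_cons, ← ih]
    simp [Formula.conj, Struct.Sat, BoundedFormula.Realize]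

theorem IsBooleanCombination.conj {V : Type} {σ : V → L.Sorts} {S : Set (L.Formula σ)}
    (l : List (L.Formula σ)) (h : ∀ α ∈ l, IsBooleanCombination S α) :
    IsBooleanCombination S (Formula.conj l) := by
  induction l with
  | nil => exact .imp .falsum .falsum
  | cons α l ih =>
    rw [List.forall_mem_cons] at h
    exact .imp (.imp h.1 (.imp (ih h.2) .falsum)) .falsum

variable {X Y : Type} {ξ : X → L.Sorts} {η : Y → L.Sorts}

theorem Struct.sat_copy (φ : L.Formula (Sum.elim ξ η)) {n : ℕ} (j : Fin n) (a : M.Tuple ξ)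
    (c : Fin n → M.Tuple η) :
    M.Sat (copy φ j) (append a (join c)) ↔ M.Sat φ (append a (c j)) := by
  refine (BoundedFormula.realize_subst _ _ _ _).trans (iff_of_eq ?_)
  unfold Struct.Sat
  congr 1
  funext v
  cases v <;> rfl

/-- The formula `⋀_{j < n} φ(x, yⱼ)^{s j}`. -/
def patternFormula (φ : L.Formula (Sum.elim ξ η)) (s : ℕ → Bool) (n : ℕ) :
    L.Formula (Sum.elim ξ fun p : Fin n × Y => η p.2) :=
  Formula.conj ((List.finRange n).map fun j : Fin n =>
    if s j then copy φ j else .imp (copy φ j) .falsum)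

theorem isBooleanCombination_patternFormula (φ : L.Formula (Sum.elim ξ η)) (s : ℕ → Bool) (n : ℕ) :
    IsBooleanCombination (Set.range fun j : Fin n => copy φ j) (patternFormula φ s n) := by
  refine .conj _ fun α hα => ?_
  obtain ⟨j, -, rfl⟩ := List.mem_map.1 hα
  split_ifs
  · exact .basic ⟨j, rfl⟩
  · exact .imp (.basic ⟨j, rfl⟩) .falsum

/-- The set defined by the conjunction of the formulas `φ(x, cⱼ)^{s j}`, `j < n`. -/
def patternSet (φ : L.Formula (Sum.elim ξ η)) (s : ℕ → Bool) (n : ℕ) (c : ℕ → M.Tuple η) :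
    Set (M.Tuple ξ) :=
  {a | ∀ j < n, a ∈ M.points φ (c j) ↔ s j = true}

theorem points_patternFormula (φ : L.Formula (Sum.elim ξ η)) (s : ℕ → Bool) (n : ℕ)
    (c : ℕ → M.Tuple η) :
    M.points (patternFormula φ s n) (Struct.join fun j : Fin n => c j) = patternSet φ s n c := by
  ext a
  simp only [Struct.points, Set.mem_ofPred_eq, patternFormula, Struct.sat_conj, List.forall_mem_map,
    List.mem_finRange, true_implies, patternSet, Fin.forall_iff]
  refine forall₂_congr fun j hj => ?_
  have := Struct.sat_copy (M := M) φ ⟨j, hj⟩ a fun j : Fin n => c j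
  dsimp only at this
  rw [← this]
  cases s j <;> simp [Struct.Sat, BoundedFormula.Realize]

namespace Preschema

variable {I : Preschema L ξ}

/-- Membership in `I(M)` asks for some representation of the set; by invariance any representation
decides it. -/
theorem DefinesIdeal.points_mem_idealAt (h : I.DefinesIdeal M) [Finite Y]
    (ψ : L.Formula (Sum.elim ξ η)) (c : M.Tuple η) :
    M.points ψ c ∈ I.idealAt M ↔ ¬ I.SatNegI M ψ c := by
  constructor
  · rintro ⟨Z, _, ζ, θ, d, hd, hn⟩ hc
    exact hn ((h.invariant ψ c θ d hd.symm).1 hc)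
  · exact fun hc => ⟨Y, ‹_›, η, ψ, c, rfl, hc⟩

theorem DefinesIdeal.patternSet_notMem_idealAt (h : I.DefinesIdeal M) [Finite Y]
    (φ : L.Formula (Sum.elim ξ η)) (s : ℕ → Bool) (n : ℕ) (c : ℕ → M.Tuple η) :
    patternSet φ s n c ∉ I.idealAt M ↔
      I.SatNegI M (patternFormula φ s n) (Struct.join fun j : Fin n => c j) := by
  rw [← points_patternFormula, h.points_mem_idealAt, not_not]

theorem DefinesIdeal.hasWideIPIn (h : I.DefinesIdeal M) [Finite Y] (φ : L.Formula (Sum.elim ξ η))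
    (b : ℕ → M.Tuple η) (hb : ∀ s n, patternSet φ s n b ∉ I.idealAt M) : I.HasWideIPIn M φ := by
  refine ⟨b, fun s F hF hFs hmem => ?_⟩
  obtain ⟨n, hn⟩ : ∃ n, ∀ E ∈ F, ∃ j < n,
      E = if s j then M.points φ (b j) else (M.points φ (b j))ᶜ := by
    choose! j hj using (fun E hE => hFs hE : ∀ E ∈ F, ∃ j,
      (if s j then M.points φ (b j) else (M.points φ (b j))ᶜ) = E)
    obtain ⟨n, hn⟩ := (hF.image j).bddAbove
    exact ⟨n + 1, fun E hE => ⟨j E, Nat.lt_succ_of_le (hn ⟨E, hE, rfl⟩), (hj E hE).symm⟩⟩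
  -- The pattern of length `n` is contained in the finite meet, so it would be thin if the meet
  -- were.
  refine hb s n (h.subset_mem _ hmem _
    ⟨_, inferInstance, _, patternFormula φ s n, _, points_patternFormula φ s n b⟩ ?_)
  intro a ha E hE
  obtain ⟨j, hj, rfl⟩ := hn E hE
  have := ha j hj
  cases hs : s j <;> simpa [hs] using this

theorem patternSet_notMem_idealAt_of_wide {φ : L.Formula (Sum.elim ξ η)} {b : ℕ → M.Tuple η}
    {a : M.Tuple ξ} (h : I.Wide M (phiType φ a (entries b))) (s : ℕ → Bool) (n : ℕ) (v : ℕ → ℕ)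
    (ha : ∀ j < n, M.Sat φ (Struct.append a (b (v j))) ↔ s j = true) :
    patternSet φ s n (fun j => b (v j)) ∉ I.idealAt M := by
  let E : ℕ → Set (M.Tuple ξ) := fun j =>
    if s j then M.points φ (b (v j)) else (M.points φ (b (v j)))ᶜ
  have hE : ⋂₀ (E '' Set.Iio n) = patternSet φ s n (fun j => b (v j)) := by
    ext x
    simp only [Set.sInter_image, Set.mem_iInter, Set.mem_Iio, patternSet, Set.mem_ofPred_eq]
    refine forall₂_congr fun j _ => ?_
    cases hs : s j <;> simp [E, hs]
  rw [← hE]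
  refine h _ ((Set.finite_Iio n).image E) ?_
  rintro _ ⟨j, hj, rfl⟩
  have hcl : M.points φ (b (v j)) ∈ BooleanSubalgebra.closure {E : Set (M.Tuple ξ) |
      ∃ c : M.Tuple η, (∀ k, ⟨η k, c k⟩ ∈ entries b) ∧ M.points φ c = E} :=
    BooleanSubalgebra.subset_closure ⟨b (v j), fun k => ⟨v j, k, rfl⟩, rfl⟩
  have haj : a ∈ M.points φ (b (v j)) ↔ s j = true := ha j hj
  cases hs : s j
  · refine ⟨?_, ?_⟩
    · simpa [E, hs] using BooleanSubalgebra.compl_mem hcl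
    · simpa [E, hs] using haj
  · refine ⟨?_, ?_⟩
    · simpa [E, hs] using hcl
    · simpa [E, hs] using haj

end Preschema

end PatternSets

/-- Coordinate `d = (A, N)` carries a list of length `2N` that is generic for the finitely many
formulas in `A`. Letting `d` tend to infinity makes the sequence generic for all formulas and its
length infinite. The positions may vary with `d`, so nonstandard places are allowed. -/
theorem exists_orderInvariant_ultrapower {L : SortedLanguage.{u}} (M : Struct.{u, max u w} L)
    {Y : Type} {η : Y → L.Sorts} (b : ℕ → M.Tuple η) (V : Ultrafilter ℕ) :
    ∃ (D : Type u) (U : Ultrafilter D) (N : D → ℕ) (B : D → ℕ → M.Tuple η),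
      Tendsto N U atTop ∧
      ∀ (n : ℕ) (θ : L.Formula fun p : Fin n × Y => η p.2) (pos : Fin n → D → ℕ),
        (∀ᶠ d in (U : Filter D), StrictMono (fun j => pos j d) ∧ ∀ j, pos j d < 2 * N d) →
        ((M.ultrapower U).Sat θ (Struct.join fun j => Struct.germTuple U fun d => B d (pos j d)) ↔
          IteratedEventually V n fun v => M.Sat θ (Struct.join fun j : Fin n => b (v.getD j 0))) := by
  classical
  let F : Type u := Σ n : ℕ, L.Formula fun p : Fin n × Y => η p.2
  let R : F → List ℕ → Prop := fun θ v =>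
    M.Sat θ.2 (Struct.join fun j : Fin θ.1 => b (v.getD j 0))
  choose l hlen hl using fun d : Finset F × ℕ =>
    exists_isGeneric_iff (V := V) d.1 Sigma.fst R (2 * d.2)
  have hU : (Ultrafilter.of (atTop : Filter (Finset F × ℕ)) : Filter (Finset F × ℕ)) ≤ atTop :=
    Ultrafilter.of_le _
  refine ⟨Finset F × ℕ, Ultrafilter.of atTop, Prod.snd, fun d k => b ((l d).getD k 0), ?_, ?_⟩
  · refine Tendsto.mono_left (?_ : Tendsto Prod.snd (atTop : Filter (Finset F × ℕ)) atTop) hU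
    rw [← prod_atTop_atTop_eq]
    exact tendsto_snd
  · intro n θ pos hpos
    refine (Struct.sat_germTuple (fun d => Struct.join fun j : Fin n =>
      b ((l d).getD (pos j d) 0)) θ).trans ?_
    have hev : ∀ᶠ d in (Ultrafilter.of (atTop : Filter (Finset F × ℕ)) : Filter _),
        (M.Sat θ (Struct.join fun j : Fin n => b ((l d).getD (pos j d) 0)) ↔
          IteratedEventually V n (R ⟨n, θ⟩)) := by
      filter_upwards [hpos, hU (eventually_ge_atTop (({⟨n, θ⟩}, 0) : Finset F × ℕ))] with d hd hd'
      have := hl d ⟨n, θ⟩ (Finset.singleton_subset_iff.1 hd'.1) _ (List.length_ofFn)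
        (ofFn_getD_sublist (l d) (fun j => pos j d) hd.1 fun j => by rw [hlen]; exact hd.2 j)
      rw [← this]
      simp [R]
    rw [eventually_congr hev, eventually_const]

/-- Separates the places `p`, `p + 1` of the swapped pair from the `p + q` others; the shift by `2`
jumps over the pair. -/
theorem forall_lt_add_two_iff {p q : ℕ} (Q : ℕ → Prop) :
    (∀ j < p + q + 2, Q j) ↔ (∀ j < p + q, Q (if j < p then j else j + 2)) ∧ Q p ∧ Q (p + 1) := by
  constructor
  · intro h
    refine ⟨fun j hj => h _ ?_, h _ (by omega), h _ (by omega)⟩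
    split_ifs <;> omega
  · rintro ⟨h, h₁, h₂⟩ j hj
    rcases lt_trichotomy j p with hp | rfl | hp
    · simpa [hp] using h j (by omega)
    · exact h₁
    · rcases Nat.eq_or_lt_of_le hp with rfl | hp'
      · exact h₂
      · have := h (j - 2) (by omega)
        rwa [if_neg (by omega), Nat.sub_add_cancel (by omega)] at this

/-- The letters of a word, located in the word that arises by inserting two letters. -/
theorem getD_append_cons_cons {A : Type*} (α β : List A) (x y z : A) (j : ℕ) :
    (α ++ x :: y :: β).getD (if j < α.length then j else j + 2) z = (α ++ β).getD j z := by
  split_ifs with h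
  · rw [List.getD_append _ _ _ _ h, List.getD_append _ _ _ _ h]
  · rw [not_lt] at h
    rw [List.getD_append_right _ _ _ _ h, List.getD_append_right _ _ _ _ (by omega),
      show j + 2 - α.length = j - α.length + 1 + 1 by omega]
    rfl

/-! ### Wide orders and sequences from a sliding parameter -/

section WideOrder

variable {L : SortedLanguage.{u}} {M : Struct.{u, w} L} {X Y : Type} {ξ : X → L.Sorts}
  {η : Y → L.Sorts}

theorem patternSet_congr (φ : L.Formula (Sum.elim ξ η)) {s t : ℕ → Bool} {n : ℕ}
    {c d : ℕ → M.Tuple η} (hs : ∀ j < n, s j = t j) (hc : ∀ j < n, c j = d j) :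
    patternSet φ s n c = patternSet φ t n d := by
  ext a
  exact forall₂_congr fun j hj => by rw [hs j hj, hc j hj]

theorem patternSet_append_cons_cons (φ : L.Formula (Sum.elim ξ η)) (α β : List Bool) (x y : Bool)
    (c : ℕ → M.Tuple η) :
    patternSet φ (fun j => (α ++ x :: y :: β).getD j false) (α.length + β.length + 2) c =
      patternSet φ (fun j => (α ++ β).getD j false) (α.length + β.length)
          (fun j => c (if j < α.length then j else j + 2)) ∩
        ({a | a ∈ M.points φ (c α.length) ↔ x = true} ∩
          {a | a ∈ M.points φ (c (α.length + 1)) ↔ y = true}) := by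
  ext a
  simp only [patternSet, Set.mem_inter_iff, Set.mem_ofPred_eq]
  rw [forall_lt_add_two_iff]
  simp only [getD_append_cons_cons]
  simp

theorem points_patternFormula_snoc (φ : L.Formula (Sum.elim ξ η)) (s : ℕ → Bool) (n : ℕ)
    (c : ℕ → M.Tuple η) (b : M.Tuple η) :
    M.points (patternFormula φ (fun j => if j = n then true else s j) (n + 1))
        (Struct.join (Fin.snoc (α := fun _ => M.Tuple η) (fun j : Fin n => c j) b)) =
      patternSet φ s n c ∩ M.points φ b := by
  have h : Fin.snoc (α := fun _ => M.Tuple η) (fun j : Fin n => c j) b =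
      fun j : Fin (n + 1) => (fun j => if j = n then b else c j) (j : ℕ) := by
    funext j
    refine Fin.lastCases ?_ (fun j => ?_) j
    · simp
    · simp [j.2.ne]
  rw [h, points_patternFormula φ _ _ fun j => if j = n then b else c j]
  ext a
  simp only [patternSet, Set.mem_inter_iff, Set.mem_ofPred_eq]
  rw [Nat.forall_lt_succ_right]
  simp only [if_true, iff_true]
  refine and_congr_left fun _ => forall₂_congr fun j hj => ?_
  rw [if_neg hj.ne, if_neg hj.ne]

theorem Preschema.isWideSOPSequence_snoc {I : Preschema L ξ} (φ : L.Formula (Sum.elim ξ η))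
    (s : ℕ → Bool) (n : ℕ) (c : ℕ → M.Tuple η) (b : ℕ → M.Tuple η)
    (h₁ : ∀ i j, i < j →
      patternSet φ s n c ∩ ((M.points φ (b i))ᶜ ∩ M.points φ (b j)) ∉ I.idealAt M)
    (h₂ : ∀ i j, i < j →
      patternSet φ s n c ∩ (M.points φ (b i) ∩ (M.points φ (b j))ᶜ) ∈ I.idealAt M) :
    I.IsWideSOPSequence M (patternFormula φ (fun j => if j = n then true else s j) (n + 1))
      fun k => Struct.join (Fin.snoc (α := fun _ => M.Tuple η) (fun j : Fin n => c j) (b k)) := by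
  intro i j hij
  simp only [points_patternFormula_snoc]
  constructor
  · convert h₁ i j hij using 2
    ext a
    simp only [Set.mem_inter_iff, Set.mem_compl_iff]
    tauto
  · convert h₂ i j hij using 1
    ext a
    simp only [Set.mem_inter_iff, Set.mem_compl_iff]
    tauto

/-- The sorted patterns are generically wide along a wide order. -/
theorem Preschema.DefinesIdeal.iteratedEventually_sat_negI {I : Preschema L ξ}
    (hI : I.DefinesIdeal M) [Finite Y]
    {V : Ultrafilter ℕ} (hV : (V : Filter ℕ) ≤ atTop)
    {φ : L.Formula (Sum.elim ξ η)} {a : ℕ → M.Tuple ξ} {b : ℕ → M.Tuple η}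
    (hab : ∀ i j, M.Sat φ (Struct.append (a i) (b j)) ↔ i < j)
    (hw : ∀ i, I.Wide M (phiType φ (a i) (entries b))) {n k : ℕ} {s : ℕ → Bool} (hkn : k ≤ n)
    (hs : ∀ j < n, s j = true ↔ k ≤ j) :
    ∀ θ ∈ I.negI (patternFormula φ s n), IteratedEventually V n fun v =>
      M.Sat θ (Struct.join fun j : Fin n => b (v.getD j 0)) := by
  intro θ hθ
  refine (iteratedEventually_increasing hV n 0).mono fun v hv => ?_
  obtain ⟨hlen, hv⟩ := hv
  have hmono : ∀ i j, i < j → j < n + 1 → (0 :: v).getD i 0 < (0 :: v).getD j 0 := by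
    intro i j hij hj
    have hj' : j < (0 :: v).length := by simpa [hlen] using hj
    rw [List.getD_eq_getElem _ _ hj', List.getD_eq_getElem _ _ (hij.trans hj')]
    exact List.pairwise_iff_getElem.1 hv _ _ _ _ hij
  -- The witness is `aᵢ` with `i` the last index carrying a letter `0`. The `0` put in front of `v`
  -- supplies this index when `k = 0`.
  refine (hI.patternSet_notMem_idealAt φ s n fun j => b (v.getD j 0)).1
    (patternSet_notMem_idealAt_of_wide (hw ((0 :: v).getD k 0)) s n (fun j => v.getD j 0)
      fun j hj => ?_) θ hθ
  rw [hab, hs j hj, show v.getD j 0 = (0 :: v).getD (j + 1) 0 from rfl]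
  constructor
  · intro h
    by_contra! hjk
    rcases Nat.eq_or_lt_of_le (Nat.succ_le_of_lt hjk) with rfl | h'
    · exact lt_irrefl _ h
    · exact lt_asymm h (hmono _ _ h' (by omega))
  · intro h
    exact hmono _ _ (by omega) (by omega)

end WideOrder

end SortedLanguage

/-! ### The dichotomy -/

open Filter in
theorem mainTheorem8 (L : SortedLanguage.{u})
    (T : L.Theory) (hT : SortedLanguage.Theory.Complete.{u, max u w} T)
    {X Y : Type} [Finite Y] (ξ : X → L.Sorts) (η : Y → L.Sorts)
    (I : SortedLanguage.Preschema L ξ)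
    (hI : SortedLanguage.Preschema.IsIdealSchema.{u, max u w} I T)
    (φ : L.Formula (Sum.elim ξ η))
    (hφ : SortedLanguage.Preschema.HasWideOP.{u, max u w} I T φ) :
    SortedLanguage.Preschema.HasWideIP.{u, max u w} I T φ ∨
    ∃ (n : ℕ) (ψ : L.Formula (Sum.elim ξ fun p : Fin (n + 1) × Y => η p.2)),
      SortedLanguage.IsBooleanCombination
        (Set.range fun j : Fin (n + 1) => SortedLanguage.copy φ j) ψ ∧
      ∃ M : SortedLanguage.Struct.{u, max u w} L, M.Models T ∧
        ∃ (c : Fin n → M.Tuple η) (b : ℕ → M.Tuple η),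
          I.IsWideSOPSequence M ψ
            fun k => SortedLanguage.Struct.join
              (Fin.snoc (α := fun _ => M.Tuple η) c (b k)) := by
  open SortedLanguage in
  obtain ⟨M, hM, a, b, hab, hw⟩ := hφ
  have hV : (hyperfilter ℕ : Filter ℕ) ≤ atTop := Nat.hyperfilter_le_atTop
  obtain ⟨D, U, N, B, hN, hB⟩ := exists_orderInvariant_ultrapower.{u, w} M b (hyperfilter ℕ)
  have hM' : (M.ultrapower U).Models T := hM.ultrapower
  have hI' := hI _ hM'
  let el : (D → ℕ) → (M.ultrapower U).Tuple η := fun p => Struct.germTuple U fun d => B d (p d)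
  let S : (ℕ → Bool) → ℕ → Prop := fun s n =>
    ∀ θ ∈ I.negI (patternFormula φ s n), IteratedEventually (hyperfilter ℕ) n fun v =>
      M.Sat θ (Struct.join fun j : Fin n => b (v.getD j 0))
  -- Order invariance: wideness of a pattern in the ultrapower does not depend on the increasing
  -- places chosen.
  have hS : ∀ (s : ℕ → Bool) (n : ℕ) (pos : ℕ → D → ℕ),
      (∀ᶠ d in (U : Filter D), ∀ j < n, (∀ i < j, pos i d < pos j d) ∧ pos j d < 2 * N d) →
      (patternSet φ s n (fun j => el (pos j)) ∉ I.idealAt (M.ultrapower U) ↔ S s n) := by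
    intro s n pos hpos
    rw [hI'.patternSet_notMem_idealAt]
    refine forall₂_congr fun θ _ => hB n θ (fun j => pos j) ?_
    filter_upwards [hpos] with d hd
    exact ⟨fun i j hij => (hd j j.2).1 i hij, fun j => (hd j j.2).2⟩
  by_cases hall : ∀ s : List Bool, S (fun j => s.getD j false) s.length
  · refine .inl ⟨_, hM', hI'.hasWideIPIn φ (fun k => el fun _ => k) fun s n => ?_⟩
    have := hall ((List.range n).map s)
    rw [List.length_map, List.length_range, ← hS _ n fun j _ => j] at this
    · rwa [patternSet_congr φ (fun j hj => ?_) fun _ _ => rfl]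
      simp [hj]
    · filter_upwards [hN.eventually_ge_atTop n] with d hd j hj
      exact ⟨fun i hi => hi, by omega⟩
  · obtain ⟨s, hs⟩ := not_forall.1 hall
    obtain ⟨α, β, hw', ht⟩ := exists_swap (fun s => S (fun j => s.getD j false) s.length)
      (fun k m => hI _ hM |>.iteratedEventually_sat_negI hV hab hw (k := k) (by simp)
        fun j hj => by
          by_cases hjk : j < k
          · rw [List.getD_append _ _ _ _ (by simpa using hjk),
              List.getD_eq_getElem _ _ (by simpa using hjk)]
            simpa using hjk
          · simp at hj
            rw [List.getD_append_right _ _ _ _ (by simpa using hjk),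
              List.getD_eq_getElem _ _ (by simp; omega)]
            simpa using hjk) s hs
    have hlen : ∀ x y : Bool, (α ++ x :: y :: β).length = α.length + β.length + 2 :=
      fun x y => by simp; omega
    rw [hlen] at hw' ht
    set p := α.length with hp
    set q := β.length
    -- The word `α` sits at the first `p` places, the pair at the standard places `p + i` and `p +
    -- k`, and `β` beyond the infinite place `N`. The length `2N` leaves room for `β`.
    let pos : ℕ → ℕ → ℕ → D → ℕ := fun i k j d =>
      if j < p then j else if j = p then p + i else if j = p + 1 then p + k else N d + j
    have hpos : ∀ i k, i < k → ∀ᶠ d in (U : Filter D), ∀ j < p + q + 2,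
        (∀ j' < j, pos i k j' d < pos i k j d) ∧ pos i k j d < 2 * N d := by
      intro i k hik
      filter_upwards [hN.eventually_ge_atTop (p + q + k + 3)] with d hd j hj
      refine ⟨fun j' hj' => ?_, ?_⟩ <;> simp only [pos] <;> split_ifs <;> omega
    -- The parameters for `α` and `β` do not depend on `i` and `k`, so `pos 0 0` can stand for them.
    have hset : ∀ (x y : Bool) (i k : ℕ),
        patternSet φ (fun j => (α ++ x :: y :: β).getD j false) (p + q + 2)
          (fun j => el (pos i k j)) =
        patternSet φ (fun j => (α ++ β).getD j false) (p + q)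
            (fun j => el (pos 0 0 (if j < p then j else j + 2))) ∩
          ({a | a ∈ (M.ultrapower U).points φ (el fun _ => p + i) ↔ x = true} ∩
            {a | a ∈ (M.ultrapower U).points φ (el fun _ => p + k) ↔ y = true}) := by
      intro x y i k
      rw [patternSet_append_cons_cons]
      congr 1
      · refine patternSet_congr φ (fun _ _ => rfl) fun j _ => congrArg el ?_
        funext d
        simp only [pos, ← hp]
        split_ifs <;> omega
      · simp [pos, ← hp]
    refine .inr ⟨p + q, _, isBooleanCombination_patternFormula φ _ _, _, hM', _, _,
      Preschema.isWideSOPSequence_snoc φ (fun j => (α ++ β).getD j false) (p + q)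
        (fun j => el (pos 0 0 (if j < p then j else j + 2))) (fun k => el fun _ => p + k)
        (fun i k hik => ?_) fun i k hik => ?_⟩
    -- For `i < k`, the letters `01` at the pair give the wide difference, and below `10` give the
    -- thin one.
    · have := (hS _ _ _ (hpos i k hik)).2 hw'
      rw [hset] at this
      simpa [Set.compl_def] using this
    · have := not_not.1 (mt (hS _ _ _ (hpos i k hik)).1 ht)
      rw [hset] at this
      simpa [Set.compl_def] using this
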